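/- Let $d\in\{2,3\}$, let $\Omega\subset\mathbb R^d$ be a bounded polygonal (polyhedral) domain, and let $\mathcal T_h$ be a finite partition of $\Omega$ into closed polytopal elements $T$ with set of flat faces (edges if $d=2$) $\mathcal E_h$; fix a unit normal $\mathbf n_e$ on each $e\in\mathcal E_h$, and write $\mathbf n$ for the outward unit normal of $T$ on $\partial T$. Let $k\ge 2$. Let $V_h$ be the space of weak functions $v=\{v_0,v_b,v_n\mathbf n_e\}$ with $v_0|_T\in P_k(T)$, $v_b|_e\in P_k(e)$, $v_n|_e\in P_{k-1}(e)$ for all $T\in\mathcal T_h$, $e\in\mathcal E_h$, and let $V_h^0$ be the subspace of those $v$ with $v_b|_e=0$, $v_n|_e=0$ for all $e\subset\partial\Omega$. For an integer $j\ge 0$ and $v\in V_h$ the weak Laplacian $\Delta_w v$ is defined on each $T$ as the unique polynomial in $P_j(T)$ with $$(\Delta_w v,\varphi)_T=(v_0,\Delta\varphi)_T-\langle v_b,\nabla\varphi\cdot\mathbf n\rangle_{\partial T}+\langle v_n\mathbf n_e\cdot\mathbf n,\varphi\rangle_{\partial T}\qquad\forall\varphi\in P_j(T),$$ and $|||v|||=(\Delta_w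 v,\Delta_w v)^{1/2}$. For $u\in H^2(\Omega)$ let $Q_hu=\{Q_0u,Q_bu,Q_n(\nabla u\cdot\mathbf n_e)\}\in V_h$, where $Q_0,Q_b,Q_n$ are the $L^2$ projections onto $P_k(T)$, $P_k(e)$, $P_{k-1}(e)$. There is an integer $j_0$, depending only on $k$ and the partition, such that the following holds for every $j$ with $j\ge j_0$, and also for every other $j$ for which $|||\cdot|||$ is a norm on $V_h^0$. Moreover, if no two faces of the same element lie in a common hyperplane and each element has at most $n$ faces, one can take $j_0\le k+2n-1$. Let $\theta\in[\tfrac12,1]$, $\bar t>0$, $N\ge1$, $\tau=\bar t/N$, $t_m=m\tau$, let $f(t)\in L^2(\Omega)$ for all $t\in[0,\bar t]$, and let $\psi\in H^2(\Omega)$. Then there is exactly one sequence $U^0,U^1,\dots,U^N$ with $U^0=Q_h\psi$, $U^m\in V_h^0$ for $1\le m\le N$, and, for all $1\le m\le N$ and all $v\in V_h^0$, $$\Big(\frac{U^m_0-U^{m-1}_0}{\tau},v_0\Big)+\big(\Delta_w(\theta U^m+(1-\theta)U^{m-1}),\Delta_w v\big)=\big(\theta f(t_m)+(1-\theta)f(t_{m-1}),v_0\big).$$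 -/

import Mathlib

open MeasureTheory Set Filter Topology
open scoped ContDiff

noncomputable section

namespace WG

/-- The space `ℝᵈ` with its Euclidean structure. -/
abbrev Pt (d : ℕ) : Type := EuclideanSpace ℝ (Fin d)

/-! ### Polytopal partitions -/

/-- A finite union of convex hulls of finite sets: a (not necessarily convex) compact polytope. -/
def IsPolytopal {d : ℕ} (S : Set (Pt d)) : Prop :=
  ∃ F : Finset (Finset (Pt d)), S = ⋃ s ∈ F, convexHull ℝ (s : Set (Pt d))

/-- A bounded polygonal (`d = 2`) or polyhedral (`d = 3`) domain. -/
structure IsPolytopalDomain {d : ℕ} (Ω : Set (Pt d)) : Prop where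
  isOpen : IsOpen Ω
  isConnected : IsConnected Ω
  isPolytopal : IsPolytopal (closure Ω)
  interior_closure : interior (closure Ω) = Ω

/-- A partition of `Ω` into finitely many closed polytopal elements `elem i`, together with the
finite set of flat closed faces `face e` (edges if `d = 2`) and a fixed choice of a unit normal
`normal e` on every face. Elements and faces need not be convex, and hanging nodes are allowed:
an element may have several faces in one hyperplane. -/
structure Mesh (d : ℕ) (Ω : Set (Pt d)) (ι κ : Type*) where
  elem : ι → Set (Pt d)
  face : κ → Set (Pt d)
  normal : κ → Pt d
  elem_isPolytopal : ∀ i, IsPolytopal (elem i)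
  elem_isConnected : ∀ i, IsConnected (interior (elem i))
  elem_regular : ∀ i, closure (interior (elem i)) = elem i
  elem_disjoint : ∀ i i', i ≠ i' → Disjoint (interior (elem i)) (interior (elem i'))
  elem_cover : ⋃ i, elem i = closure Ω
  face_isPolytopal : ∀ e, IsPolytopal (face e)
  face_finrank : ∀ e, Module.finrank ℝ (affineSpan ℝ (face e)).direction + 1 = d
  face_isConnected : ∀ e, IsConnected (intrinsicInterior ℝ (face e))
  face_regular : ∀ e, closure (intrinsicInterior ℝ (face e)) = face e
  face_disjoint : ∀ e e', e ≠ e' → Disjoint (intrinsicInterior ℝ (face e)) (face e')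
  normal_unit : ∀ e, ‖normal e‖ = 1
  normal_orthogonal : ∀ e, ∀ w ∈ (affineSpan ℝ (face e)).direction, inner ℝ (normal e) w = 0
  frontier_elem : ∀ i, frontier (elem i) = ⋃ (e : κ) (_ : face e ⊆ frontier (elem i)), face e
  face_mem : ∀ e, ∃ i, face e ⊆ frontier (elem i)

variable {d : ℕ} {Ω : Set (Pt d)} {ι κ : Type*}

/-- No two faces of the same element lie in a common hyperplane. -/
def Mesh.DistinctHyperplanes (M : Mesh d Ω ι κ) : Prop :=
  ∀ i e e', M.face e ⊆ frontier (M.elem i) → M.face e' ⊆ frontier (M.elem i) →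
    affineSpan ℝ (M.face e) = affineSpan ℝ (M.face e') → e = e'

/-- The largest number of faces of an element. -/
def Mesh.maxFaces [Fintype ι] (M : Mesh d Ω ι κ) : ℕ :=
  Finset.univ.sup fun i => Nat.card {e // M.face e ⊆ frontier (M.elem i)}

open Classical in
/-- The number `n_e · n = ±1`, where `n` is the outward unit normal of the element `i` on its
face `e`: the value is `1` iff, near the relative interior of the face, the element lies on the
side of the face opposite to `n_e`. Hence `n = outSign i e • n_e`. -/
def Mesh.outSign (M : Mesh d Ω ι κ) (i : ι) (e : κ) : ℝ :=
  if ∀ x ∈ intrinsicInterior ℝ (M.face e),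
      ∀ᶠ y in 𝓝 x, y ∈ M.elem i → inner ℝ (M.normal e) (y - x) ≤ 0
  then 1 else -1

/-- Lebesgue measure on an element. -/
def Mesh.elemMeasure (M : Mesh d Ω ι κ) (i : ι) : Measure (M.elem i) :=
  (volume : Measure (Pt d)).comap (Subtype.val)

/-- The `(d-1)`-dimensional surface measure on a face. -/
def Mesh.faceMeasure (M : Mesh d Ω ι κ) (e : κ) : Measure (M.face e) :=
  (Measure.euclideanHausdorffMeasure (d - 1) : Measure (Pt d)).comap (Subtype.val)

/-! ### Polynomial functions -/

/-- The value of a polynomial in `d` variables at a point. -/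
def ev (p : MvPolynomial (Fin d) ℝ) (x : Pt d) : ℝ := MvPolynomial.eval (fun l => x l) p

/-- Restriction of polynomials to a set. -/
def restrictTo (S : Set (Pt d)) : MvPolynomial (Fin d) ℝ →ₗ[ℝ] (S → ℝ) where
  toFun p x := ev p x.1
  map_add' p q := by ext x; simp [ev]
  map_smul' c p := by ext x; simp [ev]

/-- `P_m(S)`: the functions on `S` that are restrictions of polynomials of total degree at most
`m`. On a face this is the space of polynomials of degree at most `m` in `d - 1` flat
coordinates. -/
def polySpace (m : ℕ) (S : Set (Pt d)) : Submodule ℝ (S → ℝ) :=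
  (MvPolynomial.restrictTotalDegree (Fin d) ℝ m).map (restrictTo S)

/-- The Laplacian of a polynomial. -/
def lap (p : MvPolynomial (Fin d) ℝ) : MvPolynomial (Fin d) ℝ :=
  ∑ l, MvPolynomial.pderiv l (MvPolynomial.pderiv l p)

/-- The derivative `∇p · a` of a polynomial in the direction of a constant vector `a`. -/
def dirDeriv (a : Pt d) (p : MvPolynomial (Fin d) ℝ) : MvPolynomial (Fin d) ℝ :=
  ∑ l, MvPolynomial.C (a l) * MvPolynomial.pderiv l p

open Classical in
/-- The unique `q ∈ P_m(S)` with `∫_S q p dμ = L p` for all polynomials `p` of degree at most `m`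
(Riesz representative of a linear functional that only depends on the values of `p` on `S`). -/
def polyRep (m : ℕ) (S : Set (Pt d)) (μ : Measure S) (L : MvPolynomial (Fin d) ℝ → ℝ) :
    polySpace m S :=
  if h : ∃ q : polySpace m S, ∀ p ∈ MvPolynomial.restrictTotalDegree (Fin d) ℝ m,
      ∫ x, q.1 x * ev p x.1 ∂μ = L p
  then h.choose else 0

/-- The `L²(S)` projection of `g` onto `P_m(S)`. -/
def l2Proj (m : ℕ) (S : Set (Pt d)) (μ : Measure S) (g : Pt d → ℝ) : polySpace m S :=
  polyRep m S μ fun p => ∫ x : S, g x.1 * ev p x.1 ∂μ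

/-! ### Weak finite element spaces and the weak Laplacian -/

/-- `V_h`: triples `{v_0, v_b, v_n n_e}` with `v_0 ∈ P_k(T)` on the elements, `v_b ∈ P_k(e)` and
`v_n ∈ P_{k-1}(e)` on the faces. -/
abbrev Mesh.V (M : Mesh d Ω ι κ) (k : ℕ) : Type _ :=
  ((i : ι) → polySpace k (M.elem i)) ×
    ((e : κ) → polySpace k (M.face e)) × ((e : κ) → polySpace (k - 1) (M.face e))

/-- The interior component `v_0` on the element `i`. -/
abbrev Mesh.V.v0 {M : Mesh d Ω ι κ} {k : ℕ} (v : M.V k) (i : ι) : M.elem i → ℝ := (v.1 i).1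

/-- The component `v_b` on the face `e`. -/
abbrev Mesh.V.vb {M : Mesh d Ω ι κ} {k : ℕ} (v : M.V k) (e : κ) : M.face e → ℝ := (v.2.1 e).1

/-- The component `v_n` on the face `e`. -/
abbrev Mesh.V.vn {M : Mesh d Ω ι κ} {k : ℕ} (v : M.V k) (e : κ) : M.face e → ℝ := (v.2.2 e).1

/-- `V_h^0`: the weak functions with `v_b = 0` and `v_n = 0` on all faces contained in `∂Ω`. -/
def Mesh.V0 (M : Mesh d Ω ι κ) (k : ℕ) : Submodule ℝ (M.V k) where
  carrier := {v | ∀ e, M.face e ⊆ frontier Ω → v.2.1 e = 0 ∧ v.2.2 e = 0}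
  add_mem' {v w} hv hw e he := by simp [hv e he, hw e he]
  zero_mem' e _ := by simp
  smul_mem' c v hv e he := by simp [hv e he]

variable [Fintype ι] [Fintype κ]

open Classical in
/-- The right-hand side
`(v_0, Δφ)_T - ⟨v_b, ∇φ · n⟩_{∂T} + ⟨v_n n_e · n, φ⟩_{∂T}` defining the weak Laplacian on the
element `T = elem i`. -/
def Mesh.weakLapRhs (M : Mesh d Ω ι κ) {k : ℕ} (v : M.V k) (i : ι)
    (φ : MvPolynomial (Fin d) ℝ) : ℝ :=
  (∫ x, Mesh.V.v0 v i x * ev (lap φ) x.1 ∂(M.elemMeasure i))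
    + ∑ e with M.face e ⊆ frontier (M.elem i),
      (-(∫ x, Mesh.V.vb v e x * ev (dirDeriv (M.outSign i e • M.normal e) φ) x.1
            ∂(M.faceMeasure e))
        + (∫ x, Mesh.V.vn v e x * inner ℝ (M.normal e) (M.outSign i e • M.normal e) * ev φ x.1
            ∂(M.faceMeasure e)))

/-- The weak Laplacian `Δ_w v` on the element `i`: the unique polynomial in `P_j(T)` with
`(Δ_w v, φ)_T = (v_0, Δφ)_T - ⟨v_b, ∇φ · n⟩_{∂T} + ⟨v_n n_e · n, φ⟩_{∂T}` for all
`φ ∈ P_j(T)`. -/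
def Mesh.weakLap (M : Mesh d Ω ι κ) {k : ℕ} (j : ℕ) (v : M.V k) (i : ι) :
    polySpace j (M.elem i) :=
  polyRep j (M.elem i) (M.elemMeasure i) (M.weakLapRhs v i)

/-- The product `(v_0, w_0)` in `L²(Ω)`, as a sum over the elements. -/
def Mesh.l2Inner (M : Mesh d Ω ι κ) {k : ℕ} (v w : M.V k) : ℝ :=
  ∑ i, ∫ x, Mesh.V.v0 v i x * Mesh.V.v0 w i x ∂(M.elemMeasure i)

/-- The bilinear form `(Δ_w v, Δ_w w)`. -/
def Mesh.weakLapInner (M : Mesh d Ω ι κ) {k : ℕ} (j : ℕ) (v w : M.V k) : ℝ :=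
  ∑ i, ∫ x, (M.weakLap j v i).1 x * (M.weakLap j w i).1 x ∂(M.elemMeasure i)

/-- The product `(g, v_0)` of a function `g` on `Ω` with the interior component of `v`. -/
def Mesh.load (M : Mesh d Ω ι κ) {k : ℕ} (g : Pt d → ℝ) (v : M.V k) : ℝ :=
  ∑ i, ∫ x, g x.1 * Mesh.V.v0 v i x ∂(M.elemMeasure i)

/-- The seminorm `|||v||| = (Δ_w v, Δ_w v)^{1/2}`. -/
def Mesh.tripleNorm (M : Mesh d Ω ι κ) {k : ℕ} (j : ℕ) (v : M.V k) : ℝ :=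
  Real.sqrt (M.weakLapInner j v v)

/-- `|||·|||` is definite on `V_h^0`, that is, it is a norm there. -/
def Mesh.TripleNormDefinite (M : Mesh d Ω ι κ) (k j : ℕ) : Prop :=
  ∀ v ∈ M.V0 k, M.tripleNorm j v = 0 → v = 0

/-! ### Sobolev functions, traces and the projection `Q_h` -/

/-- `g` is the weak derivative of `u` on `Ω` in the `l`-th coordinate direction. -/
def IsWeakDeriv (Ω : Set (Pt d)) (l : Fin d) (u g : Pt d → ℝ) : Prop :=
  ∀ φ : Pt d → ℝ, ContDiff ℝ ∞ φ → HasCompactSupport φ → tsupport φ ⊆ Ω →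
    ∫ x in Ω, u x * fderiv ℝ φ x (EuclideanSpace.single l 1) = -∫ x in Ω, g x * φ x

/-- `u ∈ L²(Ω)`. -/
def MemL2 (Ω : Set (Pt d)) (u : Pt d → ℝ) : Prop := MemLp u 2 (volume.restrict Ω)

/-- `u ∈ H¹(Ω)`. -/
def MemH1 (Ω : Set (Pt d)) (u : Pt d → ℝ) : Prop :=
  MemL2 Ω u ∧ ∀ l, ∃ g, MemL2 Ω g ∧ IsWeakDeriv Ω l u g

/-- `u ∈ H²(Ω)`. -/
def MemH2 (Ω : Set (Pt d)) (u : Pt d → ℝ) : Prop :=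
  MemL2 Ω u ∧ ∀ l, ∃ g, MemH1 Ω g ∧ IsWeakDeriv Ω l u g

open Classical in
/-- The weak derivative of `u ∈ H¹(Ω)` in the `l`-th coordinate direction (unique almost
everywhere on `Ω`). -/
def weakDeriv (Ω : Set (Pt d)) (l : Fin d) (u : Pt d → ℝ) : Pt d → ℝ :=
  if h : ∃ g, MemL2 Ω g ∧ IsWeakDeriv Ω l u g then h.choose else 0

/-- `g ∈ L²(e)` is the trace of `u ∈ H¹(Ω)` on the face `e`: Green's formula
`∫_T (u ∂_l φ + ∂_l u φ) = ∫_e g φ n_l` holds on every element `T` having `e` as a face, for all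
coordinates `l` and all smooth `φ` that vanish near the rest of the boundary of `T`. -/
def Mesh.IsTrace (M : Mesh d Ω ι κ) (e : κ) (u : Pt d → ℝ) (g : Pt d → ℝ) : Prop :=
  MemLp (fun x : M.face e => g x.1) 2 (M.faceMeasure e) ∧
  ∀ i, M.face e ⊆ frontier (M.elem i) → ∀ l : Fin d, ∀ φ : Pt d → ℝ, ContDiff ℝ ∞ φ →
    HasCompactSupport φ → tsupport φ ∩ frontier (M.elem i) ⊆ intrinsicInterior ℝ (M.face e) →
    ∫ x in M.elem i,
        (u x * fderiv ℝ φ x (EuclideanSpace.single l 1) + weakDeriv Ω l u x * φ x)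
      = ∫ x : M.face e, g x.1 * φ x.1 * (M.outSign i e • M.normal e) l ∂(M.faceMeasure e)

open Classical in
/-- The trace of `u ∈ H¹(Ω)` on the face `e` (unique almost everywhere on the face). -/
def Mesh.trace (M : Mesh d Ω ι κ) (e : κ) (u : Pt d → ℝ) : Pt d → ℝ :=
  if h : ∃ g, M.IsTrace e u g then h.choose else 0

/-- The projection `Q_h u = {Q_0 u, Q_b u, Q_n (∇u · n_e)}` of `u ∈ H²(Ω)`. -/
def Mesh.Qh (M : Mesh d Ω ι κ) (k : ℕ) (u : Pt d → ℝ) : M.V k :=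
  (fun i => l2Proj k (M.elem i) (M.elemMeasure i) u,
   fun e => l2Proj k (M.face e) (M.faceMeasure e) (M.trace e u),
   fun e => l2Proj (k - 1) (M.face e) (M.faceMeasure e)
     fun x => ∑ l, M.trace e (weakDeriv Ω l u) x * M.normal e l)

/-! ### The fully discrete scheme -/

/-- `U = (U⁰, …, Uᴺ)` solves the `θ`-scheme with time step `τ`: `U⁰ = Q_h ψ` and, for
`n = 1, …, N`, `Uⁿ ∈ V_h^0` and
`((Uⁿ - Uⁿ⁻¹)/τ, v_0) + (Δ_w (θ Uⁿ + (1-θ) Uⁿ⁻¹), Δ_w v) = (θ f(t_n) + (1-θ) f(t_{n-1}), v_0)`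
for all `v ∈ V_h^0`, where `t_n = n τ`. -/
def Mesh.IsThetaSolution (M : Mesh d Ω ι κ) {k : ℕ} (j : ℕ) (θ τ : ℝ) (f : ℝ → Pt d → ℝ)
    (ψ : Pt d → ℝ) (N : ℕ) (U : Fin (N + 1) → M.V k) : Prop :=
  U 0 = M.Qh k ψ ∧
  ∀ n : Fin N, U n.succ ∈ M.V0 k ∧ ∀ v ∈ M.V0 k,
    M.l2Inner (τ⁻¹ • (U n.succ - U n.castSucc)) v
      + M.weakLapInner j (θ • U n.succ + (1 - θ) • U n.castSucc) v
    = M.load (fun x => θ * f (((n : ℕ) + 1 : ℝ) * τ) x + (1 - θ) * f (((n : ℕ) : ℝ) * τ) x) v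

end WG

end

/-!
Each step of the scheme is a linear equation on the finite-dimensional space `V_h^0`, so it has
exactly one solution as soon as the form `(u_0, v_0)/τ + θ (Δ_w u, Δ_w v)` is definite
(`existsUnique_variational`, `Mesh.existsUnique_step`); the steps are then put together by
recursion. If `u` has zero energy, then `u_0 = 0` and `Δ_w u = 0`. When `|||·|||` is a norm on
`V_h^0`, the second equation alone gives `u = 0`. For large `j` both equations are used, and they
give `u = 0` even without boundary conditions (`Mesh.exists_degree_bound`).

To see this, fix a face `e` of an element `T` and let `ℓ_{e'}` be the affine polynomial vanishing
on the hyperplane of a face `e'`. The bubble `B = ∏ ℓ_{e'}²`, over the faces `e'` of `T` in other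
hyperplanes than `e`, vanishes to second order on these faces. With `u_0 = 0`, testing the weak
Laplacian with `B ℓ_e q` leaves a combination of the integrals `∫ u_b B q` over the faces of `T` in
the hyperplane of `e`, and, once `u_b = 0`, testing with `B q` does the same for `u_n`
(`Mesh.weakLapForm_bubble_mul_facePoly`, `Mesh.weakLapForm_bubble_mul`).

If the hyperplanes are distinct, only `e` itself remains, and `q = u_b` gives `∫_e u_b² B = 0`,
hence `u_b = 0`, because `B ≥ 0` is nonzero on a dense subset of `e`. For an element with at most
`n` faces the test polynomial has degree at most `2(n - 1) + 1 + k = k + 2n - 1`. In general, the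
identities for all polynomials `q` extend to continuous `q` by the Stone–Weierstrass theorem, and a
factor that vanishes on the other coplanar faces localizes to `e`
(`Mesh.eq_zero_of_coplanar_sum`). Thus the kernels belonging to the degrees `j` decrease to zero,
and in a finite-dimensional space they reach zero at a finite `j`.
-/

namespace WG

variable {d : ℕ} {Ω : Set (Pt d)} {ι κ : Type*}

/-! ### Measures on elements and faces -/

theorem IsPolytopal.isCompact {S : Set (Pt d)} (h : IsPolytopal S) : IsCompact S := by
  obtain ⟨F, rfl⟩ := h
  exact F.isCompact_biUnion fun s _ => s.finite_toSet.isCompact_convexHull ℝ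

/-- The relative interior of a set is open in the affine span. -/
theorem exists_isOpen_intrinsicInterior_eq (S : Set (Pt d)) :
    ∃ W, IsOpen W ∧ intrinsicInterior ℝ S = W ∩ affineSpan ℝ S := by
  obtain ⟨W, hW, h⟩ := isOpen_induced_iff.1
    (isOpen_interior (s := ((↑) ⁻¹' S : Set <| affineSpan ℝ S)))
  refine ⟨W, hW, ?_⟩
  rw [intrinsicInterior, ← h, inter_comm]
  exact Subtype.image_preimage_coe _ _

theorem isometry_subtype_add (V : Submodule ℝ (Pt d)) (x₀ : Pt d) :
    Isometry fun v : V => (v : Pt d) + x₀ :=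
  (IsometryEquiv.addRight x₀).isometry.comp isometry_subtype_coe

theorem range_subtype_add (A : AffineSubspace ℝ (Pt d)) {x₀ : Pt d} (h : x₀ ∈ A) :
    range (fun v : A.direction => (v : Pt d) + x₀) = A := by
  ext y
  constructor
  · rintro ⟨v, rfl⟩
    exact AffineSubspace.vadd_mem_of_mem_direction v.2 h
  · intro hy
    exact ⟨⟨y - x₀, AffineSubspace.vsub_mem_direction hy h⟩, by simp⟩

namespace Mesh

theorem isCompact_elem (M : Mesh d Ω ι κ) (i : ι) : IsCompact (M.elem i) :=
  (M.elem_isPolytopal i).isCompact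

theorem isCompact_face (M : Mesh d Ω ι κ) (e : κ) : IsCompact (M.face e) :=
  (M.face_isPolytopal e).isCompact

instance (M : Mesh d Ω ι κ) (i : ι) : CompactSpace (M.elem i) :=
  isCompact_iff_compactSpace.1 (M.isCompact_elem i)

instance (M : Mesh d Ω ι κ) (e : κ) : CompactSpace (M.face e) :=
  isCompact_iff_compactSpace.1 (M.isCompact_face e)

theorem interior_elem_nonempty (M : Mesh d Ω ι κ) (i : ι) : (interior (M.elem i)).Nonempty :=
  (M.elem_isConnected i).nonempty

theorem face_nonempty (M : Mesh d Ω ι κ) (e : κ) : (M.face e).Nonempty :=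
  (M.face_isConnected e).nonempty.mono intrinsicInterior_subset

instance (M : Mesh d Ω ι κ) (i : ι) : IsFiniteMeasure (M.elemMeasure i) := by
  refine ⟨?_⟩
  rw [elemMeasure, comap_subtype_coe_apply (M.isCompact_elem i).measurableSet]
  simpa using (M.isCompact_elem i).measure_lt_top

instance (M : Mesh d Ω ι κ) (i : ι) : (M.elemMeasure i).IsOpenPosMeasure := by
  refine ⟨fun U hU hne h0 => ?_⟩
  rw [elemMeasure, comap_subtype_coe_apply (M.isCompact_elem i).measurableSet] at h0
  obtain ⟨W, hW, rfl⟩ := isOpen_induced_iff.1 hU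
  obtain ⟨x, hx⟩ := hne
  have hx' : (x : Pt d) ∈ closure (interior (M.elem i)) := by
    rw [M.elem_regular]; exact x.2
  obtain ⟨y, hyW, hy⟩ := mem_closure_iff.1 hx' W hW hx
  refine (hW.inter isOpen_interior).measure_ne_zero volume ⟨y, hyW, hy⟩ (measure_mono_null ?_ h0)
  rintro z ⟨hzW, hz⟩
  exact ⟨⟨z, interior_subset hz⟩, hzW, rfl⟩

theorem finrank_direction (M : Mesh d Ω ι κ) (e : κ) :
    Module.finrank ℝ (affineSpan ℝ (M.face e)).direction = d - 1 := by
  have := M.face_finrank e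
  omega

theorem isAddHaarMeasure_direction (M : Mesh d Ω ι κ) (e : κ) :
    (Measure.euclideanHausdorffMeasure (d - 1) :
      Measure (affineSpan ℝ (M.face e)).direction).IsAddHaarMeasure := by
  rw [← M.finrank_direction e]
  infer_instance

/-- The surface measure of a face is Lebesgue measure on its hyperplane, so it is finite on the
compact face. -/
instance (M : Mesh d Ω ι κ) (e : κ) : IsFiniteMeasure (M.faceMeasure e) := by
  refine ⟨?_⟩
  rw [faceMeasure, comap_subtype_coe_apply (M.isCompact_face e).measurableSet]
  obtain ⟨x₀, hx₀⟩ := M.face_nonempty e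
  have hσ := isometry_subtype_add (affineSpan ℝ (M.face e)).direction x₀
  have hr := range_subtype_add _ (subset_affineSpan ℝ _ hx₀)
  have := M.isAddHaarMeasure_direction e
  have hemb : IsClosedEmbedding fun v : (affineSpan ℝ (M.face e)).direction => (v : Pt d) + x₀ :=
    hσ.isClosedEmbedding
  have hc := (hemb.isCompact_preimage (M.isCompact_face e)).measure_lt_top
    (μ := Measure.euclideanHausdorffMeasure (d - 1))
  rw [hσ.euclideanHausdorffMeasure_preimage, hr, inter_eq_left.2 (subset_affineSpan ℝ _)] at hc
  simpa using hc

instance (M : Mesh d Ω ι κ) (e : κ) : (M.faceMeasure e).IsOpenPosMeasure := by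
  refine ⟨fun U hU hne h0 => ?_⟩
  rw [faceMeasure, comap_subtype_coe_apply (M.isCompact_face e).measurableSet] at h0
  obtain ⟨W, hW, rfl⟩ := isOpen_induced_iff.1 hU
  obtain ⟨x, hx⟩ := hne
  have hx' : (x : Pt d) ∈ closure (intrinsicInterior ℝ (M.face e)) := by
    rw [M.face_regular]; exact x.2
  obtain ⟨y, hyW, hy⟩ := mem_closure_iff.1 hx' W hW hx
  obtain ⟨W', hW', hI⟩ := exists_isOpen_intrinsicInterior_eq (M.face e)
  have hyA := subset_affineSpan ℝ _ (intrinsicInterior_subset hy)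
  have hσ := isometry_subtype_add (affineSpan ℝ (M.face e)).direction y
  have hr := range_subtype_add _ hyA
  have := M.isAddHaarMeasure_direction e
  have hy' := hy
  rw [hI] at hy'
  refine ((hW.inter hW').preimage hσ.continuous).measure_ne_zero
    (Measure.euclideanHausdorffMeasure (d - 1)) ⟨0, ?_⟩ ?_
  · simpa using ⟨hyW, hy'.1⟩
  rw [hσ.euclideanHausdorffMeasure_preimage, hr]
  refine measure_mono_null ?_ h0
  rintro z ⟨⟨hzW, hzW'⟩, hz⟩
  have hzI : z ∈ intrinsicInterior ℝ (M.face e) := by rw [hI]; exact ⟨hzW', hz⟩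
  exact ⟨⟨z, intrinsicInterior_subset hzI⟩, hzW, rfl⟩

/-- Elements lie in `Ω` up to a set of measure zero, because their boundary consists of finitely
many flat faces. -/
theorem elem_ae_subset [Finite κ] (hΩ : IsPolytopalDomain Ω) (M : Mesh d Ω ι κ) (i : ι) :
    M.elem i ≤ᵐ[volume] Ω := by
  have hfr : volume (frontier (M.elem i)) = 0 := by
    rw [M.frontier_elem]
    refine measure_iUnion_null fun e => measure_iUnion_null fun _ =>
      measure_mono_null (subset_affineSpan ℝ _) (Measure.addHaar_affineSubspace _ _ fun h => ?_)
    have h1 := M.face_finrank e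
    rw [h, AffineSubspace.direction_top, finrank_top, finrank_euclideanSpace_fin] at h1
    omega
  have hsub : M.elem i ⊆ Ω ∪ frontier (M.elem i) := by
    intro x hx
    by_cases hxi : x ∈ interior (M.elem i)
    · left
      rw [← hΩ.interior_closure]
      refine interior_mono ?_ hxi
      rw [← M.elem_cover]
      exact subset_iUnion _ i
    · exact Or.inr ⟨subset_closure hx, hxi⟩
  filter_upwards [measure_eq_zero_iff_ae_notMem.1 hfr] with x hx hxe
  exact (hsub hxe).resolve_right hx

/-! ### The hyperplane of a face -/

/-- The affine span of a face is the whole hyperplane orthogonal to the normal, by equality of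
dimensions. -/
theorem mem_affineSpan_face_iff (M : Mesh d Ω ι κ) (e : κ) {x₀ : Pt d}
    (hx₀ : x₀ ∈ affineSpan ℝ (M.face e)) (x : Pt d) :
    x ∈ affineSpan ℝ (M.face e) ↔ inner ℝ (M.normal e) (x - x₀) = 0 := by
  have hle : (affineSpan ℝ (M.face e)).direction ≤ (ℝ ∙ M.normal e)ᗮ := fun w hw => by
    rw [Submodule.mem_orthogonal_singleton_iff_inner_right]
    exact M.normal_orthogonal e w hw
  have hn : M.normal e ≠ 0 := by
    intro h
    simpa [h] using M.normal_unit e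
  have hfr : Module.finrank ℝ (ℝ ∙ M.normal e)ᗮ + 1 = d := by
    have := (ℝ ∙ M.normal e).finrank_add_finrank_orthogonal
    rw [finrank_span_singleton hn, finrank_euclideanSpace_fin] at this
    omega
  have heq := Submodule.eq_of_le_of_finrank_eq hle (by have := M.face_finrank e; omega)
  rw [← Submodule.mem_orthogonal_singleton_iff_inner_right, ← heq]
  exact ((affineSpan ℝ (M.face e)).vsub_right_mem_direction_iff_mem hx₀ x).symm

/-- A hyperplane contains a relatively open piece of a face only if it is the hyperplane of the
face. -/
theorem dense_notMem_affineSpan (M : Mesh d Ω ι κ) {e e' : κ}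
    (h : affineSpan ℝ (M.face e) ≠ affineSpan ℝ (M.face e')) :
    Dense {x : M.face e | x.1 ∉ affineSpan ℝ (M.face e')} := by
  rw [dense_iff_inter_open]
  rintro U hU ⟨x, hx⟩
  obtain ⟨W, hW, rfl⟩ := isOpen_induced_iff.1 hU
  have hx' : (x : Pt d) ∈ closure (intrinsicInterior ℝ (M.face e)) := by
    rw [M.face_regular]; exact x.2
  obtain ⟨y, hyW, hy⟩ := mem_closure_iff.1 hx' W hW hx
  by_contra hcon
  have hcon' : ∀ z : M.face e, (z : Pt d) ∈ W → (z : Pt d) ∈ affineSpan ℝ (M.face e') := by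
    intro z hz
    by_contra hz'
    exact hcon ⟨z, hz, hz'⟩
  obtain ⟨W', hW', hI⟩ := exists_isOpen_intrinsicInterior_eq (M.face e)
  have hy' := hy
  rw [hI] at hy'
  have hyF := intrinsicInterior_subset hy
  have hy2 := hcon' ⟨y, hyF⟩ hyW
  have hle : affineSpan ℝ (M.face e) ≤ affineSpan ℝ (M.face e') := by
    intro z hz
    -- A short step from `y` towards `z` stays in the piece, so the line through both is contained.
    have hcont : Continuous fun t : ℝ => AffineMap.lineMap y z t := AffineMap.lineMap_continuous
    have hev : ∀ᶠ t in 𝓝 (0 : ℝ), AffineMap.lineMap y z t ∈ W ∩ W' :=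
      hcont.continuousAt.eventually_mem
        (by simpa using (hW.inter hW').mem_nhds ⟨hyW, hy'.1⟩)
    obtain ⟨t, ht, ht0⟩ :=
      ((hev.filter_mono nhdsWithin_le_nhds).and (self_mem_nhdsWithin (s := {(0 : ℝ)}ᶜ))).exists
    have htA : AffineMap.lineMap y z t ∈ affineSpan ℝ (M.face e) :=
      AffineMap.lineMap_mem t hy'.2 hz
    have htI : AffineMap.lineMap y z t ∈ intrinsicInterior ℝ (M.face e) := by
      rw [hI]; exact ⟨ht.2, htA⟩
    have h2 := hcon' ⟨_, intrinsicInterior_subset htI⟩ ht.1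
    rw [M.mem_affineSpan_face_iff e' hy2] at h2 ⊢
    have h3 : AffineMap.lineMap y z t - y = t • (z - y) := by
      simp [AffineMap.lineMap_apply]
    simp only [h3, inner_smul_right] at h2
    exact (mul_eq_zero.1 h2).resolve_left ht0
  refine h (AffineSubspace.eq_of_direction_eq_of_nonempty_of_le ?_ ⟨y, hy'.2⟩ hle)
  exact Submodule.eq_of_le_of_finrank_eq (AffineSubspace.direction_le hle)
    (by rw [M.finrank_direction, M.finrank_direction])

end Mesh

/-! ### Polynomial functions -/

@[simp] theorem ev_zero (x : Pt d) : ev (0 : MvPolynomial (Fin d) ℝ) x = 0 := by simp [ev]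

@[simp] theorem ev_add (p q : MvPolynomial (Fin d) ℝ) (x : Pt d) :
    ev (p + q) x = ev p x + ev q x := by simp [ev]

@[simp] theorem ev_smul (c : ℝ) (p : MvPolynomial (Fin d) ℝ) (x : Pt d) :
    ev (c • p) x = c * ev p x := by simp [ev]

@[simp] theorem ev_mul (p q : MvPolynomial (Fin d) ℝ) (x : Pt d) :
    ev (p * q) x = ev p x * ev q x := by simp [ev]

@[simp] theorem ev_C (c : ℝ) (x : Pt d) : ev (MvPolynomial.C c) x = c := by simp [ev]

@[fun_prop] theorem continuous_ev (p : MvPolynomial (Fin d) ℝ) : Continuous (ev p) :=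
  (MvPolynomial.continuous_eval p).comp (by fun_prop)

theorem exists_poly_of_polySpace {m : ℕ} {S : Set (Pt d)} (q : polySpace m S) :
    ∃ p : MvPolynomial (Fin d) ℝ, p.totalDegree ≤ m ∧ ∀ x, q.1 x = ev p x.1 := by
  obtain ⟨p, hp, h⟩ := q.2
  refine ⟨p, (MvPolynomial.mem_restrictTotalDegree _ _ _).1 hp, fun x => ?_⟩
  rw [← h]
  rfl

theorem continuous_polySpace {m : ℕ} {S : Set (Pt d)} (q : polySpace m S) : Continuous q.1 := by
  obtain ⟨p, -, h⟩ := exists_poly_of_polySpace q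
  rw [show q.1 = fun x => ev p x.1 from funext h]
  fun_prop

instance (m : ℕ) (S : Set (Pt d)) : FiniteDimensional ℝ (polySpace m S) := by
  unfold polySpace
  infer_instance

theorem poly_eq_zero_of_interior {S : Set (Pt d)} (hS : (interior S).Nonempty)
    {p : MvPolynomial (Fin d) ℝ} (h : ∀ x ∈ S, ev p x = 0) : p = 0 := by
  obtain ⟨x, hx⟩ := hS
  have hopen : IsOpen ((fun y : Fin d → ℝ => (WithLp.toLp 2 y : Pt d)) ⁻¹' interior S) :=
    isOpen_interior.preimage (PiLp.continuous_toLp 2 _)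
  obtain ⟨ε, hε, hb⟩ := Metric.isOpen_iff.1 hopen (fun l => x l) hx
  rw [ball_pi _ hε] at hb
  refine MvPolynomial.funext_set (fun l => Metric.ball (x l) ε) (fun l => ?_) fun y hy => ?_
  · rw [Real.ball_eq_Ioo]
    exact Set.Ioo_infinite (by linarith)
  · simpa [ev] using h _ (interior_subset (hb hy))

/-! ### Integral pairings and Riesz representatives -/

section Pairing

variable {S : Set (Pt d)} [CompactSpace S] (μ : Measure S) [IsFiniteMeasure μ]

theorem integrable_of_continuous {f : S → ℝ}
    (hf : Continuous f) : Integrable f μ :=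
  hf.integrable_of_hasCompactSupport (HasCompactSupport.of_compactSpace f)

/-- The pairing `(q, r) ↦ ∫_S q r dμ` of polynomial functions on `S`. -/
noncomputable def polyPair (m m' : ℕ) : polySpace m S →ₗ[ℝ] polySpace m' S →ₗ[ℝ] ℝ :=
  LinearMap.mk₂ ℝ (fun q r => ∫ x, q.1 x * r.1 x ∂μ)
    (fun q q' r => by
      have h1 := continuous_polySpace q
      have h2 := continuous_polySpace q'
      have h3 := continuous_polySpace r
      simpa [add_mul] using integral_add (integrable_of_continuous μ (h1.mul h3))
        (integrable_of_continuous μ (h2.mul h3)))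
    (fun c q r => by simp [mul_assoc, integral_const_mul])
    (fun q r r' => by
      have h1 := continuous_polySpace q
      have h2 := continuous_polySpace r
      have h3 := continuous_polySpace r'
      simpa [mul_add] using integral_add (integrable_of_continuous μ (h1.mul h2))
        (integrable_of_continuous μ (h1.mul h3)))
    (fun c q r => by simp [mul_left_comm, integral_const_mul])

/-- The pairing `(q, p) ↦ ∫_S q p dμ` of a polynomial function on `S` with a polynomial. -/
noncomputable def evPair (m : ℕ) :
    polySpace m S →ₗ[ℝ] MvPolynomial (Fin d) ℝ →ₗ[ℝ] ℝ :=
  LinearMap.mk₂ ℝ (fun q p => ∫ x, q.1 x * ev p x.1 ∂μ)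
    (fun q q' p => by
      have h1 := continuous_polySpace q
      have h2 := continuous_polySpace q'
      have h3 : Continuous fun x : S => ev p x.1 := by fun_prop
      simpa [add_mul] using integral_add (integrable_of_continuous μ (h1.mul h3))
        (integrable_of_continuous μ (h2.mul h3)))
    (fun c q p => by simp [mul_assoc, integral_const_mul])
    (fun q p p' => by
      have h1 := continuous_polySpace q
      have h2 : Continuous fun x : S => ev p x.1 := by fun_prop
      have h3 : Continuous fun x : S => ev p' x.1 := by fun_prop
      simpa [mul_add] using integral_add (integrable_of_continuous μ (h1.mul h2))
        (integrable_of_continuous μ (h1.mul h3)))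
    (fun c q p => by simp [mul_left_comm, integral_const_mul])

theorem polyPair_apply {m m' : ℕ} (q : polySpace m S) (r : polySpace m' S) :
    polyPair μ m m' q r = ∫ x, q.1 x * r.1 x ∂μ := rfl

theorem evPair_apply {m : ℕ} (q : polySpace m S) (p : MvPolynomial (Fin d) ℝ) :
    evPair μ m q p = ∫ x, q.1 x * ev p x.1 ∂μ := rfl

theorem polyPair_self_nonneg {m : ℕ} (q : polySpace m S) : 0 ≤ polyPair μ m m q q :=
  integral_nonneg fun x => mul_self_nonneg (q.1 x)

variable [μ.IsOpenPosMeasure]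

/-- A polynomial function vanishes if its square has integral zero against a nonnegative weight
that is positive on a dense set. -/
theorem polySpace_eq_zero_of_integral_sq {m : ℕ} (q : polySpace m S) {w : S → ℝ}
    (hw : Continuous w) (hw0 : ∀ x, 0 ≤ w x) (hd : Dense {x | w x ≠ 0})
    (h : ∫ x, q.1 x * (q.1 x * w x) ∂μ = 0) : q = 0 := by
  have hq := continuous_polySpace q
  have hc : Continuous fun x => q.1 x * (q.1 x * w x) := by fun_prop
  have hnn : 0 ≤ fun x => q.1 x * (q.1 x * w x) := fun x => by
    have := mul_nonneg (mul_self_nonneg (q.1 x)) (hw0 x)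
    simpa [mul_assoc] using this
  have h0 := (hc.ae_eq_iff_eq μ (continuous_const (y := (0 : ℝ)))).1
    ((integral_eq_zero_iff_of_nonneg hnn (integrable_of_continuous μ hc)).1 h)
  refine Subtype.ext (hq.ext_on hd continuous_const fun x hx => ?_)
  have hx0 : q.1 x * (q.1 x * w x) = 0 := congrFun h0 x
  have hx' : w x ≠ 0 := hx
  simpa [hx'] using hx0

theorem polySpace_eq_zero_of_polyPair_self {m : ℕ} (q : polySpace m S)
    (h : polyPair μ m m q q = 0) : q = 0 :=
  polySpace_eq_zero_of_integral_sq μ q continuous_const (fun _ => zero_le_one)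
    (by simp) (by simpa [polyPair_apply] using h)

theorem polySpace_eq_of_evPair {m : ℕ} {q q' : polySpace m S}
    (h : ∀ p ∈ MvPolynomial.restrictTotalDegree (Fin d) ℝ m, evPair μ m q p = evPair μ m q' p) :
    q = q' := by
  obtain ⟨p, hp, hpx⟩ := exists_poly_of_polySpace (q - q')
  have h1 := h p ((MvPolynomial.mem_restrictTotalDegree _ _ _).2 hp)
  rw [← sub_eq_zero]
  refine polySpace_eq_zero_of_polyPair_self μ _ ?_
  rw [← sub_eq_zero, ← LinearMap.sub_apply, ← map_sub, evPair_apply] at h1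
  simpa only [polyPair_apply, hpx] using h1

/-- If `S` has interior points, then every linear functional on polynomials is represented by
integration against a polynomial function. Interior points make the restriction of polynomials to
`S` injective, so the functional need not be assumed to depend on values on `S` only. -/
theorem evPair_polyRep (hS : (interior S).Nonempty) (m : ℕ)
    (L : MvPolynomial (Fin d) ℝ →ₗ[ℝ] ℝ) {p : MvPolynomial (Fin d) ℝ} (hp : p.totalDegree ≤ m) :
    evPair μ m (polyRep m S μ L) p = L p := by
  let R := MvPolynomial.restrictTotalDegree (Fin d) ℝ m
  let T : polySpace m S →ₗ[ℝ] Module.Dual ℝ R := (Module.Dual.transpose R.subtype) ∘ₗ evPair μ m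
  have hTinj : Function.Injective T := fun q q' hq =>
    polySpace_eq_of_evPair μ fun p hp => LinearMap.congr_fun hq ⟨p, hp⟩
  have hinj : Function.Injective (restrictTo S) := by
    rw [← LinearMap.ker_eq_bot, LinearMap.ker_eq_bot']
    exact fun p hp => poly_eq_zero_of_interior hS fun x hx => congrFun hp ⟨x, hx⟩
  have hfr : Module.finrank ℝ (polySpace m S) = Module.finrank ℝ (Module.Dual ℝ R) := by
    rw [Subspace.dual_finrank_eq]
    exact (R.equivMapOfInjective _ hinj).finrank_eq.symm
  obtain ⟨q, hq⟩ := (LinearMap.injective_iff_surjective_of_finrank_eq_finrank hfr).1 hTinj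
    (L ∘ₗ R.subtype)
  have hex : ∃ q : polySpace m S, ∀ p ∈ MvPolynomial.restrictTotalDegree (Fin d) ℝ m,
      ∫ x, q.1 x * ev p x.1 ∂μ = L p := ⟨q, fun p hp => LinearMap.congr_fun hq ⟨p, hp⟩⟩
  rw [polyRep, dif_pos hex]
  exact hex.choose_spec p ((MvPolynomial.mem_restrictTotalDegree _ _ _).2 hp)

end Pairing

/-! ### Differential operators on polynomials -/

theorem dirDeriv_mul (a : Pt d) (p q : MvPolynomial (Fin d) ℝ) :
    dirDeriv a (p * q) = p * dirDeriv a q + dirDeriv a p * q := by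
  simp only [dirDeriv, MvPolynomial.pderiv_mul, Finset.mul_sum, Finset.sum_mul,
    ← Finset.sum_add_distrib]
  exact Finset.sum_congr rfl fun l _ => by ring

/-- The directional derivative of polynomials as a linear map. -/
noncomputable def dirDerivLin (a : Pt d) :
    MvPolynomial (Fin d) ℝ →ₗ[ℝ] MvPolynomial (Fin d) ℝ where
  toFun := dirDeriv a
  map_add' p q := by simp [dirDeriv, mul_add, Finset.sum_add_distrib]
  map_smul' c p := by simp [dirDeriv, Finset.smul_sum]

/-- The Laplacian of polynomials as a linear map. -/
noncomputable def lapLin : MvPolynomial (Fin d) ℝ →ₗ[ℝ] MvPolynomial (Fin d) ℝ where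
  toFun := lap
  map_add' p q := by simp [lap, Finset.sum_add_distrib]
  map_smul' c p := by simp [lap, Finset.smul_sum]

@[simp] theorem dirDerivLin_apply (a : Pt d) (p : MvPolynomial (Fin d) ℝ) :
    dirDerivLin a p = dirDeriv a p := rfl

@[simp] theorem lapLin_apply (p : MvPolynomial (Fin d) ℝ) : lapLin p = lap p := rfl

/-! ### The weak Laplacian as a linear map -/

namespace Mesh

theorem outSign_mul_self (M : Mesh d Ω ι κ) (i : ι) (e : κ) :
    M.outSign i e * M.outSign i e = 1 := by
  unfold outSign
  split_ifs <;> norm_num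

theorem outSign_ne_zero (M : Mesh d Ω ι κ) (i : ι) (e : κ) : M.outSign i e ≠ 0 :=
  left_ne_zero_of_mul_eq_one (M.outSign_mul_self i e)

theorem inner_normal_self (M : Mesh d Ω ι κ) (e : κ) :
    inner ℝ (M.normal e) (M.normal e) = (1 : ℝ) := by
  simp [M.normal_unit]

open Classical in
/-- The faces of an element. -/
noncomputable def facesOf [Fintype κ] (M : Mesh d Ω ι κ) (i : ι) : Finset κ :=
  Finset.univ.filter fun e => M.face e ⊆ frontier (M.elem i)

theorem mem_facesOf [Fintype κ] (M : Mesh d Ω ι κ) {i : ι} {e : κ} :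
    e ∈ M.facesOf i ↔ M.face e ⊆ frontier (M.elem i) := by
  simp [facesOf]

variable (M : Mesh d Ω ι κ) {k : ℕ}

section Faces

variable [Fintype κ]

/-- The right-hand side of the definition of the weak Laplacian as a bilinear form in the weak
function and the test polynomial. -/
noncomputable def weakLapForm (k : ℕ) (i : ι) :
    M.V k →ₗ[ℝ] MvPolynomial (Fin d) ℝ →ₗ[ℝ] ℝ :=
  (evPair (M.elemMeasure i) k).compl₁₂ (LinearMap.proj i ∘ₗ LinearMap.fst ℝ _ _) lapLin
    + ∑ e ∈ M.facesOf i,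
      (-((evPair (M.faceMeasure e) k).compl₁₂
          (LinearMap.proj e ∘ₗ LinearMap.fst ℝ _ _ ∘ₗ LinearMap.snd ℝ _ _)
          (dirDerivLin (M.outSign i e • M.normal e)))
        + M.outSign i e • (evPair (M.faceMeasure e) (k - 1)).compl₁₂
          (LinearMap.proj e ∘ₗ LinearMap.snd ℝ _ _ ∘ₗ LinearMap.snd ℝ _ _) LinearMap.id)

theorem weakLapForm_apply (i : ι) (v : M.V k) (φ : MvPolynomial (Fin d) ℝ) :
    M.weakLapForm k i v φ = evPair (M.elemMeasure i) k (v.1 i) (lap φ)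
      + ∑ e ∈ M.facesOf i,
        (-(evPair (M.faceMeasure e) k (v.2.1 e) (dirDeriv (M.outSign i e • M.normal e) φ))
          + M.outSign i e * evPair (M.faceMeasure e) (k - 1) (v.2.2 e) φ) := by
  simp [weakLapForm, LinearMap.sum_apply]

theorem weakLapRhs_eq (i : ι) (v : M.V k) : M.weakLapRhs v i = M.weakLapForm k i v := by
  funext φ
  rw [weakLapForm_apply, weakLapRhs]
  congr 1
  refine Finset.sum_congr (by ext e; simp [facesOf]) fun e _ => ?_
  congr 1
  rw [evPair_apply, ← integral_const_mul, inner_smul_right, inner_normal_self, mul_one]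
  exact integral_congr_ae (Eventually.of_forall fun x => by ring)

theorem evPair_weakLap (j : ℕ) (v : M.V k) (i : ι) {p : MvPolynomial (Fin d) ℝ}
    (hp : p.totalDegree ≤ j) :
    evPair (M.elemMeasure i) j (M.weakLap j v i) p = M.weakLapForm k i v p := by
  rw [weakLap, weakLapRhs_eq]
  exact evPair_polyRep _ (M.interior_elem_nonempty i) j _ hp

/-- The weak Laplacian as a linear map. -/
noncomputable def weakLapLin (k j : ℕ) (i : ι) : M.V k →ₗ[ℝ] polySpace j (M.elem i) where
  toFun v := M.weakLap j v i
  map_add' v w := polySpace_eq_of_evPair (M.elemMeasure i) fun p hp => by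
    rw [MvPolynomial.mem_restrictTotalDegree] at hp
    simp [evPair_weakLap _ _ _ _ hp]
  map_smul' c v := polySpace_eq_of_evPair (M.elemMeasure i) fun p hp => by
    rw [MvPolynomial.mem_restrictTotalDegree] at hp
    simp [evPair_weakLap _ _ _ _ hp]

end Faces

variable [Fintype ι]

/-- The form `(v_0, w_0)` as a bilinear map. -/
noncomputable def l2Bilin (k : ℕ) : M.V k →ₗ[ℝ] M.V k →ₗ[ℝ] ℝ :=
  ∑ i, (polyPair (M.elemMeasure i) k k).compl₁₂
    (LinearMap.proj i ∘ₗ LinearMap.fst ℝ _ _) (LinearMap.proj i ∘ₗ LinearMap.fst ℝ _ _)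

theorem l2Inner_eq (v w : M.V k) : M.l2Inner v w = M.l2Bilin k v w := by
  simp only [l2Bilin, LinearMap.sum_apply]
  rfl

theorem l2Bilin_self_nonneg (v : M.V k) : 0 ≤ M.l2Bilin k v v := by
  simp only [l2Bilin, LinearMap.sum_apply]
  exact Finset.sum_nonneg fun i _ => polyPair_self_nonneg _ _

theorem interior_component_eq_zero {v : M.V k} (h : M.l2Bilin k v v = 0) : v.1 = 0 := by
  simp only [l2Bilin, LinearMap.sum_apply] at h
  funext i
  exact polySpace_eq_zero_of_polyPair_self _ _ ((Finset.sum_eq_zero_iff_of_nonneg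
    fun i _ => polyPair_self_nonneg _ _).1 h i (Finset.mem_univ i))

variable [Fintype κ]

/-- The form `(Δ_w v, Δ_w w)` as a bilinear map. -/
noncomputable def weakLapBilin (k j : ℕ) : M.V k →ₗ[ℝ] M.V k →ₗ[ℝ] ℝ :=
  ∑ i, (polyPair (M.elemMeasure i) j j).compl₁₂ (M.weakLapLin k j i) (M.weakLapLin k j i)

theorem weakLapInner_eq (j : ℕ) (v w : M.V k) :
    M.weakLapInner j v w = M.weakLapBilin k j v w := by
  simp only [weakLapBilin, LinearMap.sum_apply]
  rfl

theorem weakLapBilin_self_nonneg (j : ℕ) (v : M.V k) : 0 ≤ M.weakLapBilin k j v v := by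
  simp only [weakLapBilin, LinearMap.sum_apply]
  exact Finset.sum_nonneg fun i _ => polyPair_self_nonneg _ _

theorem weakLap_eq_zero {j : ℕ} {v : M.V k} (h : M.weakLapBilin k j v v = 0) (i : ι) :
    M.weakLap j v i = 0 := by
  simp only [weakLapBilin, LinearMap.sum_apply] at h
  exact polySpace_eq_zero_of_polyPair_self _ _ ((Finset.sum_eq_zero_iff_of_nonneg
    fun i _ => polyPair_self_nonneg _ _).1 h i (Finset.mem_univ i))

/-- For `g ∈ L²(Ω)` the load functional `v ↦ (g, v_0)` is linear. -/
theorem exists_linear_load (hΩ : IsPolytopalDomain Ω) {g : Pt d → ℝ} (hg : MemL2 Ω g) :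
    ∃ ℓ : M.V k →ₗ[ℝ] ℝ, ∀ v, ℓ v = M.load g v := by
  have hint : ∀ (i : ι) (v : M.V k),
      Integrable (fun x : M.elem i => g x.1 * Mesh.V.v0 v i x) (M.elemMeasure i) := by
    intro i v
    have hgi : MemLp g 2 (volume.restrict (M.elem i)) :=
      hg.mono_measure (Measure.restrict_mono_ae (M.elem_ae_subset hΩ i))
    have : IsFiniteMeasure (volume.restrict (M.elem i)) :=
      isFiniteMeasure_restrict.2 (M.isCompact_elem i).measure_lt_top.ne
    have hg1 : Integrable (fun x : M.elem i => g x.1) (M.elemMeasure i) := by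
      have h1 := hgi.integrable one_le_two
      rw [← map_comap_subtype_coe (M.isCompact_elem i).measurableSet] at h1
      exact (MeasurableEmbedding.subtype_coe
        (M.isCompact_elem i).measurableSet).integrable_map_iff.1 h1
    have hc := continuous_polySpace (v.1 i)
    obtain ⟨C, hC⟩ := isCompact_univ.exists_bound_of_continuousOn hc.continuousOn
    exact hg1.mul_bdd hc.aestronglyMeasurable (Eventually.of_forall fun x => hC x trivial)
  refine ⟨⟨⟨M.load g, fun v w => ?_⟩, fun c v => ?_⟩, fun v => rfl⟩
  · change M.load g (v + w) = M.load g v + M.load g w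
    rw [load, load, load, ← Finset.sum_add_distrib]
    refine Finset.sum_congr rfl fun i _ => ?_
    rw [← integral_add (hint i v) (hint i w)]
    exact integral_congr_ae (Eventually.of_forall fun x => mul_add _ _ _)
  · change M.load g (c • v) = c • M.load g v
    rw [load, load, Finset.smul_sum]
    refine Finset.sum_congr rfl fun i _ => ?_
    rw [smul_eq_mul, ← integral_const_mul]
    exact integral_congr_ae (Eventually.of_forall fun x => mul_left_comm _ _ _)

end Mesh

/-! ### Approximation by polynomials -/

theorem exists_poly_near {K : Set (Pt d)} (hK : IsCompact K) {χ : Pt d → ℝ} (hχ : Continuous χ)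
    {ε : ℝ} (hε : 0 < ε) : ∃ q : MvPolynomial (Fin d) ℝ, ∀ x ∈ K, ‖ev q x - χ x‖ < ε := by
  let Φ : MvPolynomial (Fin d) ℝ →ₐ[ℝ] C(Pt d, ℝ) :=
    MvPolynomial.aeval fun l => (⟨fun x => x l, by fun_prop⟩ : C(Pt d, ℝ))
  have hΦ : ∀ p x, Φ p x = ev p x := by
    intro p x
    induction p using MvPolynomial.induction_on with
    | C a => simp [Φ, ev]
    | add p q hp hq => simp [hp, hq]
    | mul_X p l hp => rw [map_mul, ContinuousMap.mul_apply, hp]; simp [Φ, ev]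
  have hsep : Φ.range.SeparatesPoints := by
    intro x y hxy
    obtain ⟨l, hl⟩ : ∃ l, x l ≠ y l := by
      by_contra! h
      exact hxy (PiLp.ext h)
    exact ⟨_, ⟨Φ (MvPolynomial.X l), ⟨_, rfl⟩, rfl⟩, by simpa [hΦ, ev] using hl⟩
  obtain ⟨_, ⟨q, rfl⟩, hq⟩ :=
    ContinuousMap.exists_mem_subalgebra_near_continuous_of_isCompact_of_separatesPoints hsep
      ⟨χ, hχ⟩ hK hε
  exact ⟨q, fun x hx => by simpa [hΦ] using hq x hx⟩

/-- A finite product of continuous functions is nonzero on a dense set if every factor is. -/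
theorem dense_ne_zero_prod {X α : Type*} [TopologicalSpace X] (s : Finset α) (f : α → X → ℝ)
    (h : ∀ a ∈ s, Continuous (f a) ∧ Dense {x | f a x ≠ 0}) :
    Dense {x | ∏ a ∈ s, f a x ≠ 0} := by
  classical
  induction s using Finset.induction_on with
  | empty => simp
  | insert a s ha ih =>
    have h1 := h a (Finset.mem_insert_self a s)
    have h2 := ih fun b hb => h b (Finset.mem_insert_of_mem hb)
    have h3 := h1.2.inter_of_isOpen_left h2 (isOpen_ne_fun h1.1 continuous_const)
    refine h3.mono fun x hx => ?_
    simp only [Set.mem_ofPred_eq, Finset.prod_insert ha]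
    exact mul_ne_zero hx.1 hx.2

namespace Mesh

theorem evPair_congr (M : Mesh d Ω ι κ) {m : ℕ} {e : κ} (g : polySpace m (M.face e))
    {p p' : MvPolynomial (Fin d) ℝ} (h : ∀ x ∈ M.face e, ev p x = ev p' x) :
    evPair (M.faceMeasure e) m g p = evPair (M.faceMeasure e) m g p' := by
  simp only [evPair_apply]
  exact integral_congr_ae (Eventually.of_forall fun x => by simp only [h x.1 x.2])

theorem evPair_eq_zero (M : Mesh d Ω ι κ) {m : ℕ} {e : κ} (g : polySpace m (M.face e))
    {p : MvPolynomial (Fin d) ℝ} (h : ∀ x ∈ M.face e, ev p x = 0) :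
    evPair (M.faceMeasure e) m g p = 0 := by
  rw [M.evPair_congr (p' := 0) g fun x hx => by simp [h x hx], map_zero]

variable (M : Mesh d Ω ι κ)

/-! ### Bubble polynomials -/

/-- The affine polynomial `x ↦ (x - x₀) · n_e` that vanishes on the hyperplane of the face `e`,
where `x₀` is some point of the face. -/
noncomputable def facePoly (e : κ) : MvPolynomial (Fin d) ℝ :=
  ∑ l, MvPolynomial.C (M.normal e l) *
    (MvPolynomial.X l - MvPolynomial.C ((M.face_nonempty e).some l))

theorem ev_facePoly (e : κ) (x : Pt d) :
    ev (M.facePoly e) x = inner ℝ (M.normal e) (x - (M.face_nonempty e).some) := by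
  simp [facePoly, ev, PiLp.inner_apply, mul_comm]

theorem ev_facePoly_eq_zero_iff (e : κ) (x : Pt d) :
    ev (M.facePoly e) x = 0 ↔ x ∈ affineSpan ℝ (M.face e) := by
  rw [ev_facePoly]
  exact (M.mem_affineSpan_face_iff e (subset_affineSpan ℝ _ (M.face_nonempty e).some_mem) x).symm

theorem totalDegree_facePoly_le (e : κ) : (M.facePoly e).totalDegree ≤ 1 := by
  refine MvPolynomial.totalDegree_finsetSum_le fun l _ =>
    (MvPolynomial.totalDegree_mul _ _).trans ?_
  rw [MvPolynomial.totalDegree_C, zero_add]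
  exact (MvPolynomial.totalDegree_sub_C_le _ _).trans (MvPolynomial.totalDegree_X _).le

theorem dirDeriv_facePoly (a : Pt d) (e : κ) :
    dirDeriv a (M.facePoly e) = MvPolynomial.C (inner ℝ (M.normal e) a) := by
  simp only [dirDeriv, facePoly, map_sum, MvPolynomial.pderiv_mul, MvPolynomial.pderiv_C,
    map_sub, MvPolynomial.pderiv_X, zero_mul, zero_add, sub_zero, PiLp.inner_apply]
  refine Finset.sum_congr rfl fun l _ => ?_
  rw [Finset.sum_eq_single l (fun b _ hb => by simp [hb]) (by simp)]
  simp

variable [Fintype κ]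

open Classical in
/-- The faces of the element `i` in the hyperplane of the face `e`. -/
noncomputable def coplanarFaces (i : ι) (e : κ) : Finset κ :=
  (M.facesOf i).filter fun e' => affineSpan ℝ (M.face e') = affineSpan ℝ (M.face e)

open Classical in
/-- The product of `ℓ_{e'}²` over the faces `e'` of the element `i` that lie in other hyperplanes
than the face `e`. -/
noncomputable def bubble (i : ι) (e : κ) : MvPolynomial (Fin d) ℝ :=
  ∏ e' ∈ (M.facesOf i).filter fun e' => affineSpan ℝ (M.face e') ≠ affineSpan ℝ (M.face e),
    M.facePoly e' ^ 2

open Classical in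
theorem ev_bubble (i : ι) (e : κ) (x : Pt d) : ev (M.bubble i e) x =
    ∏ e' ∈ (M.facesOf i).filter fun e' => affineSpan ℝ (M.face e') ≠ affineSpan ℝ (M.face e),
      ev (M.facePoly e') x ^ 2 := by
  simp [bubble, ev]

theorem ev_bubble_nonneg (i : ι) (e : κ) (x : Pt d) : 0 ≤ ev (M.bubble i e) x := by
  rw [ev_bubble]
  exact Finset.prod_nonneg fun _ _ => sq_nonneg _

theorem dense_ev_bubble_ne_zero (i : ι) (e : κ) :
    Dense {x : M.face e | ev (M.bubble i e) x.1 ≠ 0} := by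
  classical
  simp only [ev_bubble]
  refine dense_ne_zero_prod _ (fun e' (x : M.face e) => ev (M.facePoly e') x.1 ^ 2)
    fun e' he' => ⟨by fun_prop, ?_⟩
  simpa [ev_facePoly_eq_zero_iff] using M.dense_notMem_affineSpan (Finset.mem_filter.1 he').2.symm

theorem totalDegree_bubble_le {i : ι} {e : κ} (he : e ∈ M.facesOf i) :
    (M.bubble i e).totalDegree + 2 ≤ 2 * (M.facesOf i).card := by
  classical
  have h1 : (M.bubble i e).totalDegree ≤ ∑ e' ∈ (M.facesOf i).filter
      (fun e' => affineSpan ℝ (M.face e') ≠ affineSpan ℝ (M.face e)), 2 := by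
    refine (MvPolynomial.totalDegree_finsetProd _ _).trans (Finset.sum_le_sum fun e' _ => ?_)
    refine (MvPolynomial.totalDegree_pow _ _).trans ?_
    have := M.totalDegree_facePoly_le e'
    omega
  rw [Finset.sum_const, smul_eq_mul] at h1
  have h2 : ((M.facesOf i).filter
      fun e' => affineSpan ℝ (M.face e') ≠ affineSpan ℝ (M.face e)).card < (M.facesOf i).card :=
    Finset.card_lt_card (Finset.filter_ssubset.2 ⟨e, he, by simp⟩)
  omega

/-- Multiples of the bubble vanish to second order on the faces in other hyperplanes. -/
theorem bubble_mul_vanish {i : ι} {e e' : κ} (he' : e' ∈ M.facesOf i)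
    (hne : e' ∉ M.coplanarFaces i e) (q : MvPolynomial (Fin d) ℝ) (a : Pt d) {x : Pt d}
    (hx : x ∈ M.face e') :
    ev (M.bubble i e * q) x = 0 ∧ ev (dirDeriv a (M.bubble i e * q)) x = 0 := by
  classical
  have hdvd : M.facePoly e' ^ 2 ∣ M.bubble i e := by
    refine Finset.dvd_prod_of_mem _ (Finset.mem_filter.2 ⟨he', fun h => hne ?_⟩)
    exact Finset.mem_filter.2 ⟨he', h⟩
  obtain ⟨r, hr⟩ := hdvd
  have h0 : ev (M.facePoly e') x = 0 :=
    (M.ev_facePoly_eq_zero_iff e' x).2 (subset_affineSpan ℝ _ hx)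
  have hfac : M.bubble i e * q = M.facePoly e' * (M.facePoly e' * (r * q)) := by
    rw [hr]; ring
  rw [hfac]
  constructor
  · simp [h0]
  · rw [dirDeriv_mul, dirDeriv_mul]
    simp [h0]

theorem mem_coplanarFaces_self {i : ι} {e : κ} (he : e ∈ M.facesOf i) :
    e ∈ M.coplanarFaces i e := by
  classical
  exact Finset.mem_filter.2 ⟨he, rfl⟩

theorem ev_facePoly_of_mem_coplanarFaces {i : ι} {e e' : κ} (h : e' ∈ M.coplanarFaces i e)
    {x : Pt d} (hx : x ∈ M.face e') : ev (M.facePoly e) x = 0 := by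
  classical
  rw [ev_facePoly_eq_zero_iff, ← (Finset.mem_filter.1 h).2]
  exact subset_affineSpan ℝ _ hx

/-- Testing with `B ℓ_e q`, which vanishes on every face and whose normal derivative vanishes off
the hyperplane of `e`, isolates the component `v_b` on that hyperplane. -/
theorem weakLapForm_bubble_mul_facePoly {k : ℕ} {v : M.V k} (hv : v.1 = 0) (i : ι) (e : κ)
    (q : MvPolynomial (Fin d) ℝ) :
    M.weakLapForm k i v (M.bubble i e * (M.facePoly e * q)) =
      ∑ e' ∈ M.coplanarFaces i e,
        -(inner ℝ (M.normal e) (M.outSign i e' • M.normal e')) *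
          evPair (M.faceMeasure e') k (v.2.1 e') (M.bubble i e * q) := by
  classical
  rw [weakLapForm_apply, hv, Pi.zero_apply, map_zero, LinearMap.zero_apply, zero_add]
  symm
  refine Finset.sum_subset_zero_on_sdiff (Finset.filter_subset _ _) (fun e' he' => ?_)
    fun e' he' => ?_
  · rw [Finset.mem_sdiff] at he'
    have hvan := fun (x : Pt d) (hx : x ∈ M.face e') =>
      M.bubble_mul_vanish he'.1 he'.2 (M.facePoly e * q) (M.outSign i e' • M.normal e') hx
    rw [M.evPair_eq_zero _ fun x hx => (hvan x hx).1,
      M.evPair_eq_zero _ fun x hx => (hvan x hx).2]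
    simp
  · have h0 := fun (x : Pt d) (hx : x ∈ M.face e') => M.ev_facePoly_of_mem_coplanarFaces he' hx
    rw [M.evPair_eq_zero (p := M.bubble i e * (M.facePoly e * q)) _
        fun x hx => by simp [h0 x hx],
      M.evPair_congr (p := dirDeriv _ _)
        (p' := (inner ℝ (M.normal e) (M.outSign i e' • M.normal e')) • (M.bubble i e * q)) _
        fun x hx => by
          rw [dirDeriv_mul, dirDeriv_mul, dirDeriv_facePoly]
          simp only [ev_add, ev_mul, ev_smul, ev_C, h0 x hx]
          ring]
    simp

/-- Testing with `B q` isolates the component `v_n` on the hyperplane of `e`. -/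
theorem weakLapForm_bubble_mul {k : ℕ} {v : M.V k} (hv : v.1 = 0) (i : ι) (e : κ)
    (hb : ∀ e' ∈ M.facesOf i, v.2.1 e' = 0) (q : MvPolynomial (Fin d) ℝ) :
    M.weakLapForm k i v (M.bubble i e * q) =
      ∑ e' ∈ M.coplanarFaces i e,
        M.outSign i e' * evPair (M.faceMeasure e') (k - 1) (v.2.2 e') (M.bubble i e * q) := by
  classical
  rw [weakLapForm_apply, hv, Pi.zero_apply, map_zero, LinearMap.zero_apply, zero_add]
  symm
  refine Finset.sum_subset_zero_on_sdiff (Finset.filter_subset _ _) (fun e' he' => ?_)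
    fun e' he' => ?_
  · rw [Finset.mem_sdiff] at he'
    rw [hb e' he'.1, M.evPair_eq_zero (p := M.bubble i e * q) _ fun x hx =>
      (M.bubble_mul_vanish he'.1 he'.2 q 0 hx).1]
    simp
  · rw [hb e' (Finset.mem_of_mem_filter e' he')]
    simp

/-! ### Separation of coplanar faces -/

/-- A combination of integrals over faces that vanishes against all polynomials vanishes against
all continuous functions. -/
theorem sum_integral_eq_zero_of_poly {s : Finset κ} {h : (e : κ) → M.face e → ℝ}
    (hh : ∀ e, Continuous (h e))
    (h0 : ∀ q : MvPolynomial (Fin d) ℝ, ∑ e ∈ s, ∫ x, h e x * ev q x.1 ∂(M.faceMeasure e) = 0)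
    {χ : Pt d → ℝ} (hχ : Continuous χ) :
    ∑ e ∈ s, ∫ x, h e x * χ x.1 ∂(M.faceMeasure e) = 0 := by
  set C : ℝ := ∑ e ∈ s, ∫ x, ‖h e x‖ ∂(M.faceMeasure e) with hC
  have hC0 : 0 ≤ C := Finset.sum_nonneg fun e _ => integral_nonneg fun x => norm_nonneg _
  have hbound : ∀ ε : ℝ, 0 < ε →
      ‖∑ e ∈ s, ∫ x, h e x * χ x.1 ∂(M.faceMeasure e)‖ ≤ C * ε := by
    intro ε hε
    obtain ⟨q, hq⟩ := exists_poly_near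
      (isCompact_iUnion fun e => M.isCompact_face e : IsCompact (⋃ e, M.face e)) hχ hε
    rw [← sub_zero (∑ e ∈ s, ∫ x, h e x * χ x.1 ∂(M.faceMeasure e)), ← h0 q,
      ← Finset.sum_sub_distrib, hC, Finset.sum_mul]
    refine (norm_sum_le _ _).trans (Finset.sum_le_sum fun e _ => ?_)
    have hce := hh e
    have hc1 : Continuous fun x : M.face e => h e x * χ x.1 := by fun_prop
    have hc2 : Continuous fun x : M.face e => h e x * ev q x.1 := by fun_prop
    rw [← integral_sub (integrable_of_continuous _ hc1) (integrable_of_continuous _ hc2),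
      ← integral_mul_const]
    refine norm_integral_le_of_norm_le
      (integrable_of_continuous _ (by fun_prop)) (Eventually.of_forall fun x => ?_)
    rw [← mul_sub, norm_mul, norm_sub_rev]
    exact mul_le_mul_of_nonneg_left (hq x.1 (mem_iUnion_of_mem e x.2)).le (norm_nonneg _)
  rw [← norm_le_zero_iff]
  refine le_of_forall_pos_le_add fun δ hδ => ?_
  refine (hbound (δ / (C + 1)) (by positivity)).trans ?_
  rw [zero_add, mul_div_assoc', div_le_iff₀ (by positivity)]
  nlinarith

/-- The polynomial on the face `e` vanishes if a weighted sum over the coplanar faces vanishes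
against the multiples `B q` of the bubble. If the hyperplanes are distinct, only `e` contributes
and the degree of the polynomial is enough for `q`; otherwise arbitrary `q` are needed to localize
to `e`. -/
theorem eq_zero_of_coplanar_sum {i : ι} {e : κ} (he : e ∈ M.facesOf i) {m : ℕ}
    (g : (e' : κ) → polySpace m (M.face e')) {c : κ → ℝ} (hc : c e ≠ 0)
    (h : ∀ q : MvPolynomial (Fin d) ℝ, (q.totalDegree ≤ m ∨ ¬ M.DistinctHyperplanes) →
      ∑ e' ∈ M.coplanarFaces i e,
        c e' * evPair (M.faceMeasure e') m (g e') (M.bubble i e * q) = 0) :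
    g e = 0 := by
  classical
  obtain ⟨p, hp, hpx⟩ := exists_poly_of_polySpace (g e)
  have hmem := M.mem_coplanarFaces_self he
  by_cases hD : M.DistinctHyperplanes
  · have hsingle : M.coplanarFaces i e = {e} := by
      refine Finset.eq_singleton_iff_unique_mem.2 ⟨hmem, fun e' he' => ?_⟩
      obtain ⟨h1, h2⟩ := Finset.mem_filter.1 he'
      exact hD i e' e (M.mem_facesOf.1 h1) (M.mem_facesOf.1 he) h2
    have h1 := h p (Or.inl hp)
    rw [hsingle, Finset.sum_singleton, evPair_apply] at h1
    refine polySpace_eq_zero_of_integral_sq (M.faceMeasure e) (g e)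
      (w := fun x => ev (M.bubble i e) x.1) (by fun_prop) (fun x => M.ev_bubble_nonneg i e x)
      (M.dense_ev_bubble_ne_zero i e) ?_
    rw [← (mul_eq_zero.1 h1).resolve_left hc]
    refine integral_congr_ae (Eventually.of_forall fun x => ?_)
    simp only [ev_mul, ← hpx]
    ring
  · -- The weight `δ` vanishes exactly on the other faces in the hyperplane of `e`.
    let δ : Pt d → ℝ := fun x =>
      ∏ e' ∈ (M.coplanarFaces i e).erase e, Metric.infDist x (M.face e')
    have hδ : Continuous δ :=
      continuous_finsetProd _ fun e' _ => Metric.continuous_infDist_pt _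
    have hδ0 : ∀ x, 0 ≤ δ x := fun x => Finset.prod_nonneg fun _ _ => Metric.infDist_nonneg
    have hδd : Dense {x : M.face e | δ x.1 ≠ 0} := by
      refine dense_ne_zero_prod _ (fun e' (x : M.face e) => Metric.infDist x.1 (M.face e'))
        fun e' he' => ⟨(Metric.continuous_infDist_pt _).comp continuous_subtype_val, ?_⟩
      have hne : e ≠ e' := (Finset.ne_of_mem_erase he').symm
      rw [dense_iff_inter_open]
      rintro U hU ⟨x, hx⟩
      obtain ⟨W, hW, rfl⟩ := isOpen_induced_iff.1 hU
      have hx' : (x : Pt d) ∈ closure (intrinsicInterior ℝ (M.face e)) := by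
        rw [M.face_regular]; exact x.2
      obtain ⟨y, hyW, hy⟩ := mem_closure_iff.1 hx' W hW hx
      refine ⟨⟨y, intrinsicInterior_subset hy⟩, hyW, fun h0 => ?_⟩
      have : y ∈ M.face e' := ((M.isCompact_face e').isClosed.mem_iff_infDist_zero
        (M.face_nonempty e')).2 h0
      exact disjoint_left.1 (M.face_disjoint e e' hne) hy this
    have hcont : ∀ e', Continuous fun x : M.face e' =>
        c e' * ((g e').1 x * ev (M.bubble i e) x.1) := fun e' => by
      have := continuous_polySpace (g e')
      fun_prop
    have h1 := M.sum_integral_eq_zero_of_poly (s := M.coplanarFaces i e) hcont (fun q => by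
      rw [← h q (Or.inr hD)]
      refine Finset.sum_congr rfl fun e' _ => ?_
      rw [evPair_apply, ← integral_const_mul]
      refine integral_congr_ae (Eventually.of_forall fun x => ?_)
      simp only [ev_mul]
      ring) (χ := fun x => ev p x * δ x) (by fun_prop)
    rw [Finset.sum_eq_single e] at h1
    · refine polySpace_eq_zero_of_integral_sq (M.faceMeasure e) (g e)
        (w := fun x => ev (M.bubble i e) x.1 * δ x.1) (by fun_prop)
        (fun x => mul_nonneg (M.ev_bubble_nonneg i e x) (hδ0 x)) ?_ ?_
      · refine ((M.dense_ev_bubble_ne_zero i e).inter_of_isOpen_left hδd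
          (isOpen_ne_fun (by fun_prop) continuous_const)).mono fun x hx => ?_
        exact mul_ne_zero hx.1 hx.2
      · refine (mul_eq_zero.1 (?_ : c e * _ = 0)).resolve_left hc
        rw [← integral_const_mul, ← h1]
        refine integral_congr_ae (Eventually.of_forall fun x => ?_)
        simp only [← hpx]
        ring
    · intro e' he' hne
      refine integral_eq_zero_of_ae (Eventually.of_forall fun x => ?_)
      have : δ x.1 = 0 := Finset.prod_eq_zero (Finset.mem_erase.2 ⟨hne, he'⟩)
        (Metric.infDist_zero_of_mem x.2)
      simp [this]
    · exact fun hn => absurd hmem hn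

/-! ### Definiteness -/

theorem card_facesOf_le [Fintype ι] (i : ι) : (M.facesOf i).card ≤ M.maxFaces := by
  classical
  have : (M.facesOf i).card = Nat.card {e // M.face e ⊆ frontier (M.elem i)} := by
    rw [Nat.card_eq_fintype_card, Fintype.card_subtype]
    congr
  rw [this]
  exact Finset.le_sup (f := fun i => Nat.card {e // M.face e ⊆ frontier (M.elem i)})
    (Finset.mem_univ i)

variable [Fintype ι] {k : ℕ}

/-- A weak function with zero interior component is zero if its weak Laplacian vanishes against
enough polynomials. -/
theorem eq_zero_of_weakLapForm {v : M.V k} (hv : v.1 = 0)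
    (h : ∀ i φ, (φ.totalDegree ≤ k + 2 * M.maxFaces - 1 ∨ ¬ M.DistinctHyperplanes) →
      M.weakLapForm k i v φ = 0) : v = 0 := by
  have hb : ∀ i, ∀ e ∈ M.facesOf i, v.2.1 e = 0 := by
    intro i e he
    refine M.eq_zero_of_coplanar_sum he v.2.1
      (c := fun e' => -(inner ℝ (M.normal e) (M.outSign i e' • M.normal e'))) ?_ fun q hq => ?_
    · simp [inner_smul_right, M.normal_unit, M.outSign_ne_zero]
    · rw [← M.weakLapForm_bubble_mul_facePoly hv]
      refine h i _ (hq.imp_left fun hq => ?_)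
      have h1 := MvPolynomial.totalDegree_mul (M.bubble i e) (M.facePoly e * q)
      have h2 := MvPolynomial.totalDegree_mul (M.facePoly e) q
      have h3 := M.totalDegree_facePoly_le e
      have h4 := M.totalDegree_bubble_le he
      have h5 := M.card_facesOf_le i
      omega
  have hn : ∀ i, ∀ e ∈ M.facesOf i, v.2.2 e = 0 := by
    intro i e he
    refine M.eq_zero_of_coplanar_sum he v.2.2 (M.outSign_ne_zero i e) fun q hq => ?_
    rw [← M.weakLapForm_bubble_mul hv i e (hb i)]
    refine h i _ (hq.imp_left fun hq => ?_)
    have h1 := MvPolynomial.totalDegree_mul (M.bubble i e) q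
    have h4 := M.totalDegree_bubble_le he
    have h5 := M.card_facesOf_le i
    omega
  refine Prod.ext hv (Prod.ext (funext fun e => ?_) (funext fun e => ?_))
  · obtain ⟨i, hi⟩ := M.face_mem e
    exact hb i e (M.mem_facesOf.2 hi)
  · obtain ⟨i, hi⟩ := M.face_mem e
    exact hn i e (M.mem_facesOf.2 hi)

/-- For `j` large enough, only the zero weak function has zero interior component and zero weak
Laplacian. -/
theorem exists_degree_bound (k : ℕ) : ∃ j₀ : ℕ,
    (M.DistinctHyperplanes → j₀ ≤ k + 2 * M.maxFaces - 1) ∧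
    ∀ j, j₀ ≤ j → ∀ v : M.V k, v.1 = 0 → (∀ i, M.weakLap j v i = 0) → v = 0 := by
  have hform : ∀ {j : ℕ} {v : M.V k}, (∀ i, M.weakLap j v i = 0) → ∀ i φ, φ.totalDegree ≤ j →
      M.weakLapForm k i v φ = 0 := fun hv i φ hφ => by
    rw [← M.evPair_weakLap _ _ _ hφ, hv, map_zero, LinearMap.zero_apply]
  by_cases hD : M.DistinctHyperplanes
  · exact ⟨k + 2 * M.maxFaces - 1, fun _ => le_rfl, fun j hj v hv hw =>
      M.eq_zero_of_weakLapForm hv fun i φ hφ =>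
        hform hw i φ ((hφ.resolve_right (not_not_intro hD)).trans hj)⟩
  · -- The kernels decrease with `j` in a finite-dimensional space, so they become stationary, and
    -- their intersection is zero.
    let K : ℕ →o (Submodule ℝ (M.V k))ᵒᵈ :=
      { toFun := fun j => OrderDual.toDual
          { carrier := {v | v.1 = 0 ∧ ∀ i φ, φ.totalDegree ≤ j → M.weakLapForm k i v φ = 0}
            add_mem' := fun {v w} hv hw =>
              ⟨by simp [hv.1, hw.1], fun i φ hφ => by simp [hv.2 i φ hφ, hw.2 i φ hφ]⟩
            zero_mem' := ⟨rfl, fun i φ _ => by simp⟩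
            smul_mem' := fun c v hv =>
              ⟨by simp [hv.1], fun i φ hφ => by simp [hv.2 i φ hφ]⟩ }
        monotone' := fun j j' hj v hv => ⟨hv.1, fun i φ hφ => hv.2 i φ (hφ.trans hj)⟩ }
    obtain ⟨j₀, hj₀⟩ := IsArtinian.monotone_stabilizes K
    refine ⟨j₀, fun h => absurd h hD, fun j hj v hv hw => M.eq_zero_of_weakLapForm hv
      fun i φ _ => ?_⟩
    have hmem : v ∈ OrderDual.ofDual (K j) := ⟨hv, hform hw⟩
    rw [← hj₀ j hj, hj₀ (max j₀ φ.totalDegree) (le_max_left _ _)] at hmem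
    exact hmem.2 i φ (le_max_right _ _)

end Mesh

/-! ### The time stepping scheme -/

/-- A recursion with a uniquely solvable step has exactly one solution. -/
theorem existsUnique_recursion {X : Type*} {N : ℕ} (P : Fin N → X → X → Prop)
    (hP : ∀ n x, ∃! y, P n x y) (x₀ : X) :
    ∃! U : Fin (N + 1) → X, U 0 = x₀ ∧ ∀ n : Fin N, P n (U n.castSucc) (U n.succ) := by
  choose f hf hu using hP
  refine ⟨Fin.induction x₀ f, ⟨rfl, fun n => hf n _⟩, fun U hU => funext fun n => ?_⟩
  induction n using Fin.induction with
  | zero => exact hU.1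
  | succ n ih =>
    rw [hu n _ _ (hU.2 n), ih]
    rfl

/-- In finite dimension a variational equation on a subspace is uniquely solvable if its bilinear
form is definite there: the induced map to the dual is injective, hence surjective. -/
theorem existsUnique_variational {E : Type*} [AddCommGroup E] [Module ℝ E]
    [FiniteDimensional ℝ E] (W : Submodule ℝ E) (a : E →ₗ[ℝ] E →ₗ[ℝ] ℝ)
    (ha : ∀ u ∈ W, a u u = 0 → u = 0) (ℓ : E →ₗ[ℝ] ℝ) :
    ∃! u, u ∈ W ∧ ∀ v ∈ W, a u v = ℓ v := by
  let A : W →ₗ[ℝ] Module.Dual ℝ W := a.compl₁₂ W.subtype W.subtype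
  have hinj : Function.Injective A := by
    rw [← LinearMap.ker_eq_bot, LinearMap.ker_eq_bot']
    exact fun u hu => Subtype.ext (ha u u.2 (LinearMap.congr_fun hu u))
  obtain ⟨u, hu⟩ := (LinearMap.injective_iff_surjective_of_finrank_eq_finrank
    Subspace.dual_finrank_eq.symm).1 hinj (ℓ ∘ₗ W.subtype)
  refine ⟨u, ⟨u.2, fun v hv => LinearMap.congr_fun hu ⟨v, hv⟩⟩, fun w hw => ?_⟩
  have : A ⟨w, hw.1⟩ = A u := by
    rw [hu]
    exact LinearMap.ext fun v => hw.2 v v.2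
  exact congrArg Subtype.val (hinj this)

namespace Mesh

variable [Fintype ι] [Fintype κ] (M : Mesh d Ω ι κ) {k : ℕ}

/-- One step of the scheme: the form `(u_0, v_0)/τ + θ (Δ_w u, Δ_w v)` is definite as soon as zero
interior component together with zero weak Laplacian imply that the weak function is zero. -/
theorem existsUnique_step (hΩ : IsPolytopalDomain Ω) {j : ℕ} {θ τ : ℝ} (hθ : 0 < θ) (hτ : 0 < τ)
    (hdef : ∀ u ∈ M.V0 k, M.l2Bilin k u u = 0 → M.weakLapBilin k j u u = 0 → u = 0)
    {g : Pt d → ℝ} (hg : MemL2 Ω g) (w : M.V k) :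
    ∃! u, u ∈ M.V0 k ∧ ∀ v ∈ M.V0 k,
      M.l2Inner (τ⁻¹ • (u - w)) v + M.weakLapInner j (θ • u + (1 - θ) • w) v = M.load g v := by
  obtain ⟨ℓ, hℓ⟩ := M.exists_linear_load (k := k) hΩ hg
  have hτ' : 0 < τ⁻¹ := inv_pos.2 hτ
  have h := existsUnique_variational (M.V0 k) (τ⁻¹ • M.l2Bilin k + θ • M.weakLapBilin k j)
    (fun u hu h0 => by
      have h1 := mul_nonneg hτ'.le (M.l2Bilin_self_nonneg u)
      have h2 := mul_nonneg hθ.le (M.weakLapBilin_self_nonneg j u)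
      simp only [LinearMap.add_apply, LinearMap.smul_apply, smul_eq_mul] at h0
      rw [add_eq_zero_iff_of_nonneg h1 h2] at h0
      exact hdef u hu ((mul_eq_zero.1 h0.1).resolve_left hτ'.ne')
        ((mul_eq_zero.1 h0.2).resolve_left hθ.ne'))
    (ℓ + τ⁻¹ • M.l2Bilin k w - (1 - θ) • M.weakLapBilin k j w)
  refine (existsUnique_congr fun u => and_congr_right fun _ => forall₂_congr fun v _ => ?_).1 h
  rw [l2Inner_eq, weakLapInner_eq, ← hℓ]
  simp only [map_add, map_sub, map_smul, LinearMap.add_apply, LinearMap.sub_apply,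
    LinearMap.smul_apply, smul_eq_mul]
  constructor <;> intro h <;> linarith

end Mesh

end WG

theorem mainTheorem8 {d : ℕ} (hd : d = 2 ∨ d = 3) {Ω : Set (WG.Pt d)}
    (hΩ : WG.IsPolytopalDomain Ω) {ι κ : Type*} [Fintype ι] [Fintype κ]
    (M : WG.Mesh d Ω ι κ) (k : ℕ) (hk : 2 ≤ k) :
    ∃ j₀ : ℕ, (M.DistinctHyperplanes → j₀ ≤ k + 2 * M.maxFaces - 1) ∧
      ∀ j : ℕ, (j₀ ≤ j ∨ M.TripleNormDefinite k j) →
      ∀ (θ : ℝ), θ ∈ Set.Icc (1 / 2 : ℝ) 1 →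
      ∀ (tbar : ℝ), 0 < tbar → ∀ (N : ℕ), 0 < N →
      ∀ (f : ℝ → WG.Pt d → ℝ), (∀ t ∈ Set.Icc 0 tbar, WG.MemL2 Ω (f t)) →
      ∀ (ψ : WG.Pt d → ℝ), WG.MemH2 Ω ψ →
      ∃! U : Fin (N + 1) → M.V k, M.IsThetaSolution j θ (tbar / N) f ψ N U := by
  obtain ⟨j₀, hj₀, hdef₀⟩ := M.exists_degree_bound k
  refine ⟨j₀, hj₀, fun j hj θ hθ tbar ht N hN f hf ψ _ => ?_⟩
  have hdef : ∀ u ∈ M.V0 k, M.l2Bilin k u u = 0 → M.weakLapBilin k j u u = 0 → u = 0 := by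
    intro u hu h0 hΔ
    rcases hj with hj | hj
    · exact hdef₀ j hj u (M.interior_component_eq_zero h0) (M.weakLap_eq_zero hΔ)
    · exact hj u hu (by rw [WG.Mesh.tripleNorm, M.weakLapInner_eq, hΔ, Real.sqrt_zero])
  have hN' : (0 : ℝ) < N := Nat.cast_pos.2 hN
  have hθ' : 0 < θ := by linarith [hθ.1]
  refine WG.existsUnique_recursion
    (fun n w u => u ∈ M.V0 k ∧ ∀ v ∈ M.V0 k, M.l2Inner ((tbar / N)⁻¹ • (u - w)) v
      + M.weakLapInner j (θ • u + (1 - θ) • w) v = M.load (fun x =>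
        θ * f (((n : ℕ) + 1 : ℝ) * (tbar / N)) x + (1 - θ) * f (((n : ℕ) : ℝ) * (tbar / N)) x) v)
    (fun n w => M.existsUnique_step hΩ hθ' (by positivity) hdef ?_ w) (M.Qh k ψ)
  -- The times `t_n` and `t_{n+1}` lie in `[0, tbar]`.
  have hmem : ∀ s : ℝ, 0 ≤ s → s ≤ N → s * (tbar / N) ∈ Set.Icc 0 tbar := fun s h0 h1 => by
    refine ⟨by positivity, ?_⟩
    rw [mul_div_assoc', div_le_iff₀ hN', mul_comm tbar]
    exact mul_le_mul_of_nonneg_right h1 ht.le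
  have hn : ((n : ℕ) + 1 : ℝ) ≤ N := by exact_mod_cast n.2
  exact ((hf _ (hmem _ (by positivity) hn)).const_mul θ).add
    ((hf _ (hmem _ (by positivity) (by linarith))).const_mul (1 - θ))
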